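/- Let $A$ be a commutative ring. For an $A$-module $M$ write $M^*=\operatorname{Hom}_A(M,A)$, let $\operatorname{Sym}(M)=\bigoplus_n \operatorname{Sym}^n(M)$ be the symmetric algebra, and let $\Gamma(M)=\bigoplus_n\Gamma^n(M)$ be the algebra of divided powers, generated by the symbols $\gamma^n(x)$ ($n\in\mathbb N$, $x\in M$) subject to $\gamma^0(x)=1$, $\gamma^n(ax)=a^n\gamma^n(x)$, $\gamma^m(x)\gamma^n(x)=\binom{m+n}{m}\gamma^{m+n}(x)$ and $\gamma^n(x+y)=\sum_{i+j=n}\gamma^i(x)\gamma^j(y)$, with $\gamma^n(x)$ of degree $n$; in particular $\Gamma^1(M)\cong M$ via $x\mapsto\gamma^1(x)$. The comultiplication $\Delta\colon\Gamma(M)\to\Gamma(M\oplus M)\cong\Gamma(M)\otimes_A\Gamma(M)$ induced by the diagonal $M\to M\oplus M$, given by $\gamma^n(x)\mapsto\sum_{i+j=n}\gamma^i(x)\otimes\gamma^j(x)$, makes $\Gamma(M)$ a graded commutative and cocommutative bialgebra. Hence the graded dual $\Gamma(M)^\vee=\bigoplus_n\operatorname{Hom}_A(\Gamma^n(M),A)$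 is a graded commutative $A$-algebra, with $(u\bullet v)(\gamma)=(u\otimes v)(\Delta(\gamma))$ for $u\in\Gamma^i(M)^*$, $v\in\Gamma^j(M)^*$, $\gamma\in\Gamma^{i+j}(M)$, and a homomorphism $M\to N$ induces a homomorphism $\Gamma(N)^\vee\to\Gamma(M)^\vee$ of graded $A$-algebras. **(a)** For every finitely generated $A$-module $M$, the canonical map $M^*\cong\Gamma^1(M)^*\subseteq\Gamma(M)^\vee$ extends uniquely to an $A$-algebra homomorphism $\Phi_M\colon\operatorname{Sym}(M^*)\to\Gamma(M)^\vee$. It is graded, and natural in $M$: for each homomorphism $M\to N$ of finitely generated $A$-modules, the composite $\operatorname{Sym}(N^*)\xrightarrow{\Phi_N}\Gamma(N)^\vee\to\Gamma(M)^\vee$ equals the composite $\operatorname{Sym}(N^*)\to\operatorname{Sym}(M^*)\xrightarrow{\Phi_M}\Gamma(M)^\vee$. If $M$ is moreover free, then $\Phi_M$ is an isomorphism of graded $A$-algebras. **(b)** Let $F$ be a free $A$-module with basis $x_1,\dots,x_n$. The monomials $\gamma^{m}(x)=\gamma^{m_1}(x_1)\cdots\gamma^{m_n}(x_n)$, $m\in\mathbb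 N^n$, form a basis of $\Gamma(F)$, and the dual functionals $\gamma^m(x)^*\in\Gamma^{m_1+\dots+m_n}(F)^*$ form a basis of $\Gamma(F)^\vee$. Each $\gamma^1(x_i)^*$ is the image of the dual basis element $x_i^*\in F^*$ under the canonical map. This dual basis is multiplicative: $\gamma^0(x)^*=1$ and $\gamma^m(x)^*\bullet\gamma^r(x)^*=\gamma^{m+r}(x)^*$ for all $m,r\in\mathbb N^n$, so that $\gamma^m(x)^*=(\gamma^1(x_1)^*)^{m_1}\bullet\cdots\bullet(\gamma^1(x_n)^*)^{m_n}$. Consequently there is an isomorphism of graded $A$-algebras $A[T_1,\dots,T_n]\to\Gamma(F)^\vee$, with each $T_i$ of degree $1$, sending $T_i$ to $\gamma^1(x_i)^*$. -/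

import Mathlib

noncomputable section

open TensorProduct

/-! ### The graded dual of a graded coalgebra -/

namespace GradedDual

section Defs

variable {A B : Type*} [CommRing A] [AddCommGroup B] [Module A B]

/-- The degree `n` part of the graded dual. -/
abbrev Piece (𝒜 : ℕ → Submodule A B) (n : ℕ) : Type _ := Module.Dual A (𝒜 n)

/-- The span of all `x ⊗ y` with `x`, `y` homogeneous of total degree `n`, that is, the degree `n`
part of `B ⊗ B`. -/
def tensorGrade (𝒜 : ℕ → Submodule A B) (n : ℕ) : Submodule A (B ⊗[A] B) :=
  Submodule.span A {z | ∃ i j : ℕ, i + j = n ∧ ∃ x ∈ 𝒜 i, ∃ y ∈ 𝒜 j, z = x ⊗ₜ[A] y}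

/-- The comultiplication and the counit are homogeneous of degree `0`. -/
class IsGradedCoalgebra [Coalgebra A B] (𝒜 : ℕ → Submodule A B) : Prop where
  comul_mem : ∀ (n : ℕ) (x : B), x ∈ 𝒜 n → Coalgebra.comul (R := A) x ∈ tensorGrade 𝒜 n
  counit_eq_zero : ∀ (n : ℕ) (x : B), x ∈ 𝒜 n → n ≠ 0 → Coalgebra.counit (R := A) x = 0

/-- A functional on the degree `n` part, extended by zero to all other degrees. -/
def ext (𝒜 : ℕ → Submodule A B) [DirectSum.Decomposition 𝒜] {n : ℕ} (u : Piece 𝒜 n) :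
    B →ₗ[A] A :=
  u ∘ₗ DirectSum.component A ℕ (fun i => 𝒜 i) n ∘ₗ
    (DirectSum.decomposeLinearEquiv 𝒜).toLinearMap

end Defs

section Lemmas

variable {A B : Type*} [CommRing A] [AddCommGroup B] [Module A B]
  {𝒜 : ℕ → Submodule A B} [DirectSum.Decomposition 𝒜]

lemma ext_apply {n : ℕ} (u : Piece 𝒜 n) (x : B) :
    ext 𝒜 u x = u (DirectSum.decompose 𝒜 x n) := rfl

lemma ext_apply_coe {n : ℕ} (u : Piece 𝒜 n) (x : 𝒜 n) : ext 𝒜 u x = u x := by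
  rw [ext_apply]; simp

lemma ext_apply_of_ne {n m : ℕ} (u : Piece 𝒜 n) {x : B} (hx : x ∈ 𝒜 m) (h : m ≠ n) :
    ext 𝒜 u x = 0 := by
  rw [ext_apply, show DirectSum.decompose 𝒜 x n = 0 from
    Subtype.ext (DirectSum.decompose_of_mem_ne 𝒜 hx h), map_zero]

lemma ext_smul {n : ℕ} (r : A) (u : Piece 𝒜 n) : ext 𝒜 (r • u) = r • ext 𝒜 u := rfl

lemma mk_eq_mk {i j : ℕ} (h : i = j) {u : Piece 𝒜 i} {v : Piece 𝒜 j}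
    (huv : ext 𝒜 u = ext 𝒜 v) : GradedMonoid.mk (A := Piece 𝒜) i u = GradedMonoid.mk j v := by
  subst h
  congr 1
  refine LinearMap.ext fun x => ?_
  rw [← ext_apply_coe, ← ext_apply_coe, huv]

lemma linearMap_ext {f g : B →ₗ[A] A} (h : ∀ n, ∀ x ∈ 𝒜 n, f x = g x) : f = g := by
  refine DirectSum.decompose_lhom_ext 𝒜 fun n => ?_
  ext x
  exact h n x x.2

end Lemmas

section Mul

variable {A B : Type*} [CommRing A] [AddCommGroup B] [Module A B] [Coalgebra A B]

/-- The product of functionals `u` and `v` of degrees `i` and `j`: the restriction to degree `i + j`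
of `(u ⊗ v) ∘ Δ`. -/
def mul (𝒜 : ℕ → Submodule A B) [DirectSum.Decomposition 𝒜] {i j : ℕ}
    (u : Piece 𝒜 i) (v : Piece 𝒜 j) : Piece 𝒜 (i + j) :=
  LinearMap.mul' A A ∘ₗ TensorProduct.map (ext 𝒜 u) (ext 𝒜 v) ∘ₗ
    Coalgebra.comul ∘ₗ (𝒜 (i + j)).subtype

/-- The unit of the graded dual: the restriction of the counit to degree `0`. -/
def one (𝒜 : ℕ → Submodule A B) : Piece 𝒜 0 := Coalgebra.counit ∘ₗ (𝒜 0).subtype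

instance instGMul (𝒜 : ℕ → Submodule A B) [DirectSum.Decomposition 𝒜] :
    GradedMonoid.GMul (Piece 𝒜) where
  mul := mul 𝒜

instance instGOne (𝒜 : ℕ → Submodule A B) : GradedMonoid.GOne (Piece 𝒜) where
  one := one 𝒜

variable {𝒜 : ℕ → Submodule A B} [DirectSum.Decomposition 𝒜]

lemma gmul_def {i j : ℕ} (u : Piece 𝒜 i) (v : Piece 𝒜 j) :
    GradedMonoid.GMul.mul u v = mul 𝒜 u v := rfl

lemma mul_zero' {i j : ℕ} (a : Piece 𝒜 i) : mul 𝒜 a (0 : Piece 𝒜 j) = 0 :=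
  LinearMap.ext fun x => by simp [mul, ext]

lemma zero_mul' {i j : ℕ} (b : Piece 𝒜 j) : mul 𝒜 (0 : Piece 𝒜 i) b = 0 :=
  LinearMap.ext fun x => by simp [mul, ext]

lemma mul_add' {i j : ℕ} (a : Piece 𝒜 i) (b c : Piece 𝒜 j) :
    mul 𝒜 a (b + c) = mul 𝒜 a b + mul 𝒜 a c :=
  LinearMap.ext fun x => by simp [mul, ext, LinearMap.add_comp, TensorProduct.map_add_right]

lemma add_mul' {i j : ℕ} (a b : Piece 𝒜 i) (c : Piece 𝒜 j) :
    mul 𝒜 (a + b) c = mul 𝒜 a c + mul 𝒜 b c :=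
  LinearMap.ext fun x => by simp [mul, ext, LinearMap.add_comp, TensorProduct.map_add_left]

variable [IsGradedCoalgebra 𝒜]

lemma ext_mul {i j : ℕ} (u : Piece 𝒜 i) (v : Piece 𝒜 j) :
    ext 𝒜 (mul 𝒜 u v) = (WithConv.toConv (ext 𝒜 u) * WithConv.toConv (ext 𝒜 v)).ofConv := by
  refine linearMap_ext (𝒜 := 𝒜) fun n x hx => ?_
  by_cases hn : n = i + j
  · subst hn
    exact ext_apply_coe _ ⟨x, hx⟩
  · rw [ext_apply_of_ne _ hx hn]
    have key : ∀ z ∈ tensorGrade 𝒜 n,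
        LinearMap.mul' A A (TensorProduct.map (ext 𝒜 u) (ext 𝒜 v) z) = 0 := by
      intro z hz
      induction hz using Submodule.span_induction with
      | mem z hz =>
        obtain ⟨a, b, hab, x, hx, y, hy, rfl⟩ := hz
        by_cases ha : a = i
        · have hb : b ≠ j := by omega
          simp [ext_apply_of_ne v hy hb]
        · simp [ext_apply_of_ne u hx ha]
      | zero => simp
      | add _ _ _ _ h₁ h₂ => simp only [map_add, h₁, h₂, add_zero]
      | smul r _ _ h => simp only [map_smul, h, smul_zero]
    exact (key _ (IsGradedCoalgebra.comul_mem n x hx)).symm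

lemma ext_one : ext 𝒜 (one 𝒜) = (1 : WithConv (B →ₗ[A] A)).ofConv := by
  refine linearMap_ext (𝒜 := 𝒜) fun n x hx => ?_
  by_cases hn : n = 0
  · subst hn
    exact ext_apply_coe _ ⟨x, hx⟩
  · rw [ext_apply_of_ne _ hx hn]
    exact (IsGradedCoalgebra.counit_eq_zero (A := A) n x hx hn).symm

instance instGSemiring : DirectSum.GSemiring (Piece 𝒜) where
  mul_zero a := mul_zero' a
  zero_mul b := zero_mul' b
  mul_add a b c := mul_add' a b c
  add_mul a b c := add_mul' a b c
  one_mul := by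
    rintro ⟨i, u⟩
    refine mk_eq_mk (zero_add i) ?_
    change ext 𝒜 (mul 𝒜 (one 𝒜) u) = _
    rw [ext_mul, ext_one, WithConv.toConv_ofConv, one_mul]
  mul_one := by
    rintro ⟨i, u⟩
    refine mk_eq_mk (add_zero i) ?_
    change ext 𝒜 (mul 𝒜 u (one 𝒜)) = _
    rw [ext_mul, ext_one, WithConv.toConv_ofConv, mul_one]
  mul_assoc := by
    rintro ⟨i, u⟩ ⟨j, v⟩ ⟨k, w⟩
    refine mk_eq_mk (add_assoc i j k) ?_
    change ext 𝒜 (mul 𝒜 (mul 𝒜 u v) w) = ext 𝒜 (mul 𝒜 u (mul 𝒜 v w))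
    rw [ext_mul, ext_mul, ext_mul, ext_mul, WithConv.toConv_ofConv, WithConv.toConv_ofConv,
      mul_assoc]
  natCast n := n • one 𝒜
  natCast_zero := zero_smul _ _
  natCast_succ n := succ_nsmul _ _

instance instGCommSemiring [Coalgebra.IsCocomm A B] : DirectSum.GCommSemiring (Piece 𝒜) where
  mul_comm := by
    rintro ⟨i, u⟩ ⟨j, v⟩
    refine mk_eq_mk (add_comm i j) ?_
    change ext 𝒜 (mul 𝒜 u v) = ext 𝒜 (mul 𝒜 v u)
    rw [ext_mul, ext_mul, mul_comm]

instance instGAlgebra : DirectSum.GAlgebra A (Piece 𝒜) where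
  toFun := (LinearMap.toSpanSingleton A (Piece 𝒜 0) (one 𝒜)).toAddMonoidHom
  map_one := one_smul A (one 𝒜)
  map_mul r s := by
    refine mk_eq_mk (zero_add 0).symm ?_
    change ext 𝒜 ((r * s) • one 𝒜) = ext 𝒜 (mul 𝒜 (r • one 𝒜) (s • one 𝒜))
    rw [ext_mul, ext_smul, ext_smul, ext_smul, ext_one, WithConv.toConv_smul, WithConv.toConv_smul,
      WithConv.toConv_ofConv, smul_mul_smul_comm, mul_one, WithConv.ofConv_smul]
  commutes := by
    rintro r ⟨i, u⟩
    refine mk_eq_mk (add_comm 0 i) ?_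
    change ext 𝒜 (mul 𝒜 (r • one 𝒜) u) = ext 𝒜 (mul 𝒜 u (r • one 𝒜))
    rw [ext_mul, ext_mul, ext_smul, ext_one, WithConv.toConv_smul,
      WithConv.toConv_ofConv, smul_mul_assoc, mul_smul_comm, mul_one, one_mul]
  smul_def := by
    rintro r ⟨i, u⟩
    refine mk_eq_mk (zero_add i).symm ?_
    change ext 𝒜 (r • u) = ext 𝒜 (mul 𝒜 (r • one 𝒜) u)
    rw [ext_mul, ext_smul, ext_smul, ext_one, WithConv.toConv_smul,
      WithConv.toConv_ofConv, smul_mul_assoc, one_mul]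
    rfl

end Mul

end GradedDual

open scoped DirectSum in
/-- The graded dual `⨁ n, Hom(𝒜 n, A)` of a graded module `B = ⨁ n, 𝒜 n`. For a graded
cocommutative coalgebra it is a commutative algebra under the multiplication dual to the comultiplication. -/
abbrev GradedDual {A B : Type*} [CommRing A] [AddCommGroup B] [Module A B]
    (𝒜 : ℕ → Submodule A B) : Type _ := ⨁ n, GradedDual.Piece 𝒜 n

namespace GradedDual

variable {A B C : Type*} [CommRing A] [AddCommGroup B] [Module A B] [AddCommGroup C] [Module A C]

/-- The inclusion of the degree `n` part. -/
abbrev of (𝒜 : ℕ → Submodule A B) (n : ℕ) : Module.Dual A (𝒜 n) →ₗ[A] GradedDual 𝒜 :=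
  DirectSum.lof A ℕ (Piece 𝒜) n

/-- The degree `n` part, as a submodule. -/
def grade (𝒜 : ℕ → Submodule A B) (n : ℕ) : Submodule A (GradedDual 𝒜) :=
  LinearMap.range (of 𝒜 n)

/-- The transpose of a linear map preserving the degree. -/
def mapLinear {𝒜 : ℕ → Submodule A B} {ℬ : ℕ → Submodule A C} (f : B →ₗ[A] C) (hf : ∀ n, ∀ x ∈ 𝒜 n, f x ∈ ℬ n) :
    GradedDual ℬ →ₗ[A] GradedDual 𝒜 :=
  DirectSum.lmap fun n => (f.restrict (hf n)).dualMap

lemma mapLinear_of {𝒜 : ℕ → Submodule A B} {ℬ : ℕ → Submodule A C} (f : B →ₗ[A] C) (hf : ∀ n, ∀ x ∈ 𝒜 n, f x ∈ ℬ n) (n : ℕ) (u : Piece ℬ n) :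
    mapLinear f hf (of ℬ n u) = of 𝒜 n ((f.restrict (hf n)).dualMap u) :=
  DirectSum.lmap_lof (fun n => (f.restrict (hf n)).dualMap) n u

lemma one_def [Coalgebra A B] (𝒜 : ℕ → Submodule A B) :
    (1 : GradedDual 𝒜) = of 𝒜 0 (one 𝒜) := rfl

variable (𝒜 : ℕ → Submodule A B) [DirectSum.Decomposition 𝒜]
  (ℬ : ℕ → Submodule A C) [DirectSum.Decomposition ℬ]

variable {ℬ} in
lemma ext_dualMap (f : B →ₗ[A] C) (hf : ∀ n, ∀ x ∈ 𝒜 n, f x ∈ ℬ n) {n : ℕ} (u : Piece ℬ n) :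
    ext 𝒜 ((f.restrict (hf n)).dualMap u) = ext ℬ u ∘ₗ f := by
  refine linearMap_ext (𝒜 := 𝒜) fun m x hx => ?_
  by_cases h : m = n
  · subst h
    rw [ext_apply_coe _ ⟨x, hx⟩, LinearMap.comp_apply, ext_apply_coe _ ⟨f x, hf m x hx⟩]
    rfl
  · rw [ext_apply_of_ne _ hx h, LinearMap.comp_apply, ext_apply_of_ne _ (hf m x hx) h]

variable [Coalgebra A B] [Coalgebra A C] [IsGradedCoalgebra 𝒜] [IsGradedCoalgebra ℬ]

lemma of_mul_of {i j : ℕ} (u : Piece 𝒜 i) (v : Piece 𝒜 j) :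
    of 𝒜 i u * of 𝒜 j v = of 𝒜 (i + j) (mul 𝒜 u v) := DirectSum.of_mul_of u v

/-- A homomorphism of graded coalgebras induces a homomorphism of graded duals, given in degree `n`
by the transpose of its degree `n` part. -/
def map (f : B →ₗc[A] C) (hf : ∀ n, ∀ x ∈ 𝒜 n, (f : B →ₗ[A] C) x ∈ ℬ n) :
    GradedDual ℬ →ₐ[A] GradedDual 𝒜 :=
  AlgHom.ofLinearMap (mapLinear (f : B →ₗ[A] C) hf)
    (by
      rw [one_def, one_def, mapLinear_of]
      congr 1
      refine LinearMap.ext fun x => ?_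
      exact CoalgHomClass.counit_comp_apply f (x : B))
    (fun y z => by
      induction y using DirectSum.induction_on with
      | zero => rw [zero_mul, map_zero, zero_mul]
      | add y y' h h' => rw [add_mul, map_add, map_add, add_mul, h, h']
      | of i u =>
        induction z using DirectSum.induction_on with
        | zero => rw [mul_zero, map_zero, mul_zero]
        | add z z' h h' => rw [mul_add, map_add, map_add, mul_add, h, h']
        | of j v =>
          simp only [← DirectSum.lof_eq_of A]
          change mapLinear _ hf (of ℬ i u * of ℬ j v) = mapLinear _ hf (of ℬ i u) *
            mapLinear _ hf (of ℬ j v)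
          rw [of_mul_of, mapLinear_of, mapLinear_of, mapLinear_of, of_mul_of]
          congr 1
          refine LinearMap.ext fun x => ?_
          rw [← ext_apply_coe, ← ext_apply_coe, ext_dualMap, ext_mul, ext_mul, ext_dualMap,
            ext_dualMap]
          exact LinearMap.congr_fun (LinearMap.convMul_comp_coalgHom_distrib _ _ f) x)

lemma map_of (f : B →ₗc[A] C) (hf : ∀ n, ∀ x ∈ 𝒜 n, (f : B →ₗ[A] C) x ∈ ℬ n) (n : ℕ)
    (u : Piece ℬ n) :
    map 𝒜 ℬ f hf (of ℬ n u) = of 𝒜 n (((f : B →ₗ[A] C).restrict (hf n)).dualMap u) :=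
  mapLinear_of _ hf n u

end GradedDual
/-! ### The bialgebra structure of the algebra of divided powers -/

namespace DividedPowerAlgebra

open Finset.HasAntidiagonal (antidiagonal mem_antidiagonal)

variable {A M N : Type*} [CommRing A] [AddCommGroup M] [Module A M] [AddCommGroup N] [Module A N]

lemma hom_ext {S : Type*} [Semiring S] [Algebra A S] {f g : DividedPowerAlgebra A M →ₐ[A] S}
    (h : ∀ n x, f (dp A n x) = g (dp A n x)) : f = g := by
  refine AlgHom.ext fun y => ?_
  induction y using DividedPowerAlgebra.induction_on with
  | C r => rw [AlgHom.commutes, AlgHom.commutes]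
  | add y z hy hz => rw [map_add, map_add, hy, hz]
  | dp y n x hy => rw [map_mul, map_mul, hy, h]

lemma antidiagonal_sum_mul_aux {S : Type*} [CommSemiring S] (a b : ℕ → S)
    (ha : ∀ n p, a n * a p = (n + p).choose n • a (n + p))
    (hb : ∀ n p, b n * b p = (n + p).choose n • b (n + p)) (n p : ℕ) :
    (∑ k ∈ antidiagonal n, a k.1 * b k.2) * (∑ k ∈ antidiagonal p, a k.1 * b k.2) =
      (n + p).choose n • ∑ k ∈ antidiagonal (n + p), a k.1 * b k.2 := by
  have h : ∀ k ∈ antidiagonal (n + p), (n + p).choose n • (a k.1 * b k.2) =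
      ∑ q ∈ antidiagonal n, (k.1.choose q.1 * k.2.choose q.2) • (a k.1 * b k.2) := by
    intro k hk
    rw [← mem_antidiagonal.1 hk, Nat.add_choose_eq, Finset.sum_smul]
  rw [Finset.smul_sum, Finset.sum_congr rfl h, Finset.sum_comm, Finset.sum_mul]
  refine Finset.sum_congr rfl fun q hq => ?_
  rw [Finset.mul_sum]
  refine Finset.sum_of_injOn (fun r => (q.1 + r.1, q.2 + r.2)) ?_ ?_ ?_ ?_
  · rintro ⟨r, s⟩ - ⟨r', s'⟩ - h
    simpa using h
  · rintro ⟨r, s⟩ hr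
    simp only [Finset.mem_coe, mem_antidiagonal] at *
    omega
  · rintro ⟨r, s⟩ hr hrs
    rw [mem_antidiagonal] at hr hq
    by_cases h₁ : r < q.1
    · simp [Nat.choose_eq_zero_of_lt h₁]
    by_cases h₂ : s < q.2
    · simp [Nat.choose_eq_zero_of_lt h₂]
    refine absurd ⟨(r - q.1, s - q.2), ?_, ?_⟩ hrs
    · simp only [Finset.mem_coe, mem_antidiagonal] at *
      omega
    · simp only [Prod.mk.injEq]
      omega
  · rintro ⟨r, s⟩ hr
    calc _ = (a q.1 * a r) * (b q.2 * b s) := by ring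
      _ = _ := by
        rw [ha, hb, smul_mul_smul_comm]

lemma antidiagonal_sum_add_aux {S : Type*} [CommSemiring S] (a a' b b' : ℕ → S) (n : ℕ) :
    ∑ k ∈ antidiagonal n, (∑ p ∈ antidiagonal k.1, a p.1 * a' p.2) *
        (∑ p ∈ antidiagonal k.2, b p.1 * b' p.2) =
      ∑ k ∈ antidiagonal n, (∑ p ∈ antidiagonal k.1, a p.1 * b p.2) *
        (∑ p ∈ antidiagonal k.2, a' p.1 * b' p.2) := by
  have := congrArg (PowerSeries.coeff n) (mul_mul_mul_comm (PowerSeries.mk a) (PowerSeries.mk a')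
    (PowerSeries.mk b) (PowerSeries.mk b'))
  simpa only [PowerSeries.coeff_mul, PowerSeries.coeff_mk] using this

lemma antidiagonal_sum_assoc_aux {S : Type*} [Semiring S] (a b c : ℕ → S) (n : ℕ) :
    ∑ k ∈ antidiagonal n, (∑ p ∈ antidiagonal k.1, a p.1 * b p.2) * c k.2 =
      ∑ k ∈ antidiagonal n, a k.1 * (∑ p ∈ antidiagonal k.2, b p.1 * c p.2) := by
  have := congrArg (PowerSeries.coeff n) (mul_assoc (PowerSeries.mk a) (PowerSeries.mk b)
    (PowerSeries.mk c))
  simpa only [PowerSeries.coeff_mul, PowerSeries.coeff_mk] using this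

lemma antidiagonal_sum_tmul_aux {B : Type*} [CommRing B] [Algebra A B] (d : ℕ → B) (n : ℕ) :
    ∑ k ∈ antidiagonal n, ∑ p ∈ antidiagonal k.1, d p.1 ⊗ₜ[A] (d p.2 ⊗ₜ[A] d k.2) =
      ∑ k ∈ antidiagonal n, ∑ p ∈ antidiagonal k.2, d k.1 ⊗ₜ[A] (d p.1 ⊗ₜ[A] d p.2) := by
  have := antidiagonal_sum_assoc_aux (fun n => d n ⊗ₜ[A] ((1 : B) ⊗ₜ[A] (1 : B)))
    (fun n => (1 : B) ⊗ₜ[A] (d n ⊗ₜ[A] (1 : B))) (fun n => (1 : B) ⊗ₜ[A] ((1 : B) ⊗ₜ[A] d n)) n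
  simpa only [Algebra.TensorProduct.tmul_mul_tmul, one_mul, mul_one, Finset.sum_mul,
    Finset.mul_sum] using this

variable (A M N) in
/-- The homomorphism `γⁿ(x, y) ↦ ∑_{i+j=n} γⁱ(x) ⊗ γʲ(y)`. -/
def prodToTensor :
    DividedPowerAlgebra A (M × N) →ₐ[A] DividedPowerAlgebra A M ⊗[A] DividedPowerAlgebra A N :=
  lift' (f := fun nz => ∑ k ∈ antidiagonal nz.1, dp A k.1 nz.2.1 ⊗ₜ[A] dp A k.2 nz.2.2)
    (fun m => by simp [dp_zero, Algebra.TensorProduct.one_def])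
    (fun n r m => by
      simp only [Prod.smul_fst, Prod.smul_snd, dp_smul, Finset.smul_sum]
      refine Finset.sum_congr rfl fun k hk => ?_
      rw [TensorProduct.smul_tmul_smul, ← pow_add, mem_antidiagonal.1 hk])
    (fun n p m => by
      have := antidiagonal_sum_mul_aux
        (fun n => dp A n m.1 ⊗ₜ[A] (1 : DividedPowerAlgebra A N))
        (fun n => (1 : DividedPowerAlgebra A M) ⊗ₜ[A] dp A n m.2)
        (fun n p => by
          simp only [Algebra.TensorProduct.tmul_mul_tmul, dp_mul, mul_one, TensorProduct.smul_tmul'])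
        (fun n p => by
          simp only [Algebra.TensorProduct.tmul_mul_tmul, dp_mul, mul_one, TensorProduct.tmul_smul])
        n p
      simpa only [Algebra.TensorProduct.tmul_mul_tmul, one_mul, mul_one] using this)
    (fun n u v => by
      have := antidiagonal_sum_add_aux
        (fun n => dp A n u.1 ⊗ₜ[A] (1 : DividedPowerAlgebra A N))
        (fun n => dp A n v.1 ⊗ₜ[A] (1 : DividedPowerAlgebra A N))
        (fun n => (1 : DividedPowerAlgebra A M) ⊗ₜ[A] dp A n u.2)
        (fun n => (1 : DividedPowerAlgebra A M) ⊗ₜ[A] dp A n v.2) n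
      simp only [Algebra.TensorProduct.tmul_mul_tmul, one_mul, mul_one, ← TensorProduct.sum_tmul,
        ← TensorProduct.tmul_sum] at this
      simpa only [Prod.fst_add, Prod.snd_add, dp_add] using this)

lemma prodToTensor_dp (n : ℕ) (z : M × N) : prodToTensor A M N (dp A n z) =
    ∑ k ∈ antidiagonal n, dp A k.1 z.1 ⊗ₜ[A] dp A k.2 z.2 := lift'_apply_dp _ _ _ _ _ _

lemma sum_dp_zero_right {S : Type*} [AddCommMonoid S] (n : ℕ)
    (f : ℕ → DividedPowerAlgebra A N → S) (hf : ∀ i, f i 0 = 0) :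
    ∑ k ∈ antidiagonal n, f k.1 (dp A k.2 (0 : N)) = f n 1 := by
  rw [Finset.sum_eq_single (n, 0)]
  · simp [dp_zero]
  · rintro ⟨i, j⟩ hij hne
    rw [mem_antidiagonal] at hij
    rw [dp_null_of_ne_zero, hf]
    rintro rfl
    exact hne (by simpa using hij)
  · intro h; simp at h

lemma sum_dp_zero_left {S : Type*} [AddCommMonoid S] (n : ℕ)
    (f : ℕ → DividedPowerAlgebra A N → S) (hf : ∀ i, f i 0 = 0) :
    ∑ k ∈ antidiagonal n, f k.2 (dp A k.1 (0 : N)) = f n 1 := by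
  rw [Finset.sum_eq_single (0, n)]
  · simp [dp_zero]
  · rintro ⟨i, j⟩ hij hne
    rw [mem_antidiagonal] at hij
    rw [dp_null_of_ne_zero, hf]
    rintro rfl
    exact hne (by simpa using hij)
  · intro h; simp at h

variable (A M N) in
/-- The algebra of divided powers takes direct sums to tensor products. -/
def prodEquiv :
    DividedPowerAlgebra A (M × N) ≃ₐ[A] DividedPowerAlgebra A M ⊗[A] DividedPowerAlgebra A N :=
  AlgEquiv.ofAlgHom (prodToTensor A M N)
    (Algebra.TensorProduct.productMap (map A (LinearMap.inl A M N)) (map A (LinearMap.inr A M N)))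
    (by
      apply Algebra.TensorProduct.ext
      · refine hom_ext fun n x => ?_
        simp only [AlgHom.comp_apply, Algebra.TensorProduct.includeLeft_apply,
          Algebra.TensorProduct.productMap_apply_tmul, map_one, mul_one, map_apply_dp,
          prodToTensor_dp, LinearMap.inl_apply, AlgHom.id_apply]
        exact sum_dp_zero_right n (fun i y => dp A i x ⊗ₜ[A] y) (by simp)
      · refine hom_ext fun n x => ?_
        simp only [AlgHom.comp_apply, AlgHom.restrictScalars_apply,
          Algebra.TensorProduct.includeRight_apply,
          Algebra.TensorProduct.productMap_apply_tmul, map_one, one_mul, map_apply_dp,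
          prodToTensor_dp, LinearMap.inr_apply, AlgHom.id_apply]
        exact sum_dp_zero_left n (fun i y => y ⊗ₜ[A] dp A i x) (by simp))
    (by
      refine hom_ext fun n z => ?_
      simp only [AlgHom.comp_apply, prodToTensor_dp, map_sum, map_apply_dp,
        Algebra.TensorProduct.productMap_apply_tmul, AlgHom.id_apply]
      rw [← dp_add]
      simp)

variable (A M) in
/-- The comultiplication `Γ(M) → Γ(M ⊕ M) ≅ Γ(M) ⊗ Γ(M)` induced by the diagonal `M → M ⊕ M`. -/
def comulHom : DividedPowerAlgebra A M →ₐ[A] DividedPowerAlgebra A M ⊗[A] DividedPowerAlgebra A M :=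
  (prodEquiv A M M).toAlgHom.comp (map A (LinearMap.prod LinearMap.id LinearMap.id))

lemma comulHom_dp (n : ℕ) (x : M) :
    comulHom A M (dp A n x) = ∑ k ∈ antidiagonal n, dp A k.1 x ⊗ₜ[A] dp A k.2 x := by
  change prodToTensor A M M (map A _ (dp A n x)) = _
  rw [map_apply_dp, prodToTensor_dp]
  rfl

variable (A M) in
/-- The counit `Γ(M) → A`, which is `Γ(M) → Γ(0) = A`. -/
def counitHom : DividedPowerAlgebra A M →ₐ[A] A :=
  lift' (f := fun nx => if nx.1 = 0 then 1 else 0)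
    (fun _ => if_pos rfl)
    (fun n r x => by by_cases h : n = 0 <;> simp [h])
    (fun n p x => by by_cases h : n = 0 <;> by_cases h' : p = 0 <;> simp [h, h'])
    (fun n x y => by
      by_cases h : n = 0
      · subst h; simp
      · rw [if_neg h, eq_comm]
        refine Finset.sum_eq_zero fun k hk => ?_
        rw [mem_antidiagonal] at hk
        by_cases h₁ : k.1 = 0
        · have h₂ : k.2 ≠ 0 := by omega
          simp [h₂]
        · simp [h₁])

lemma counitHom_dp (n : ℕ) (x : M) :
    counitHom A M (dp A n x) = if n = 0 then 1 else 0 := lift'_apply_dp _ _ _ _ _ _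

instance instBialgebra : Bialgebra A (DividedPowerAlgebra A M) :=
  Bialgebra.ofAlgHom (comulHom A M) (counitHom A M)
    (by
      refine hom_ext fun n x => ?_
      have := antidiagonal_sum_tmul_aux (A := A) (fun n => dp A n x) n
      simpa [comulHom_dp, TensorProduct.sum_tmul, TensorProduct.tmul_sum] using this)
    (by
      refine hom_ext fun n x => ?_
      simp only [AlgHom.comp_apply, comulHom_dp, map_sum, Algebra.TensorProduct.map_tmul,
        counitHom_dp, AlgHom.id_apply]
      rw [Finset.sum_eq_single (0, n)]
      · simp
      · rintro ⟨i, j⟩ hij hne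
        rw [mem_antidiagonal] at hij
        rw [if_neg, TensorProduct.zero_tmul]
        rintro rfl
        exact hne (by simpa using hij)
      · intro h; simp at h)
    (by
      refine hom_ext fun n x => ?_
      simp only [AlgHom.comp_apply, comulHom_dp, map_sum, Algebra.TensorProduct.map_tmul,
        counitHom_dp, AlgHom.id_apply]
      rw [Finset.sum_eq_single (n, 0)]
      · simp
      · rintro ⟨i, j⟩ hij hne
        rw [mem_antidiagonal] at hij
        rw [if_neg, TensorProduct.tmul_zero]
        rintro rfl
        exact hne (by simpa using hij)
      · intro h; simp at h)

lemma comul_dp (n : ℕ) (x : M) : Coalgebra.comul (R := A) (dp A n x) =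
    ∑ k ∈ antidiagonal n, dp A k.1 x ⊗ₜ[A] dp A k.2 x := comulHom_dp n x

lemma counit_dp (n : ℕ) (x : M) :
    Coalgebra.counit (R := A) (dp A n x) = if n = 0 then 1 else 0 := counitHom_dp n x

instance instIsCocomm : Coalgebra.IsCocomm A (DividedPowerAlgebra A M) where
  comm_comp_comul := by
    have h : (Algebra.TensorProduct.comm A (DividedPowerAlgebra A M)
          (DividedPowerAlgebra A M)).toAlgHom.comp (Bialgebra.comulAlgHom A _) =
        Bialgebra.comulAlgHom A (DividedPowerAlgebra A M) := by
      refine hom_ext fun n x => ?_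
      simp only [AlgHom.comp_apply, Bialgebra.comulAlgHom_apply, comul_dp]
      simp only [map_sum]
      exact Finset.sum_nbij' Prod.swap Prod.swap (by simp [add_comm]) (by simp [add_comm])
        (by simp) (by simp) (by simp)
    exact congr(($h).toLinearMap)

/-- `Γ(g)` as a homomorphism of bialgebras. -/
def mapBialgHom (g : M →ₗ[A] N) : DividedPowerAlgebra A M →ₐc[A] DividedPowerAlgebra A N :=
  BialgHom.ofAlgHom (map A g)
    (hom_ext fun n x => by
      simp only [AlgHom.comp_apply, map_apply_dp, Bialgebra.counitAlgHom_apply, counit_dp])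
    (hom_ext fun n x => by
      simp only [AlgHom.comp_apply, map_apply_dp, Bialgebra.comulAlgHom_apply, comul_dp, map_sum,
        Algebra.TensorProduct.map_tmul])

/-! ### The grading of the algebra of divided powers -/

variable (A M) in
/-- `Γⁿ(M)`, generated by the products `γ^{n₁}(x₁) ⋯ γ^{nₖ}(xₖ)` with `n₁ + ⋯ + nₖ = n`. -/
def grade (n : ℕ) : Submodule A (DividedPowerAlgebra A M) :=
  Submodule.span A {y | ∃ l : List (ℕ × M), (l.map Prod.fst).sum = n ∧
    y = (l.map fun p => dp A p.1 p.2).prod}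

lemma dp_mem_grade (n : ℕ) (x : M) : dp A n x ∈ grade A M n :=
  Submodule.subset_span ⟨[(n, x)], by simp, by simp⟩

instance instGradedMonoid : SetLike.GradedMonoid (grade A M) where
  one_mem := Submodule.subset_span ⟨[], by simp, by simp⟩
  mul_mem i j a b ha hb := by
    have := Submodule.mul_mem_mul ha hb
    rw [grade, grade, Submodule.span_mul_span] at this
    refine Submodule.span_mono ?_ this
    rintro _ ⟨_, ⟨l, hl, rfl⟩, _, ⟨l', hl', rfl⟩, rfl⟩
    exact ⟨l ++ l', by simp [hl, hl'], by simp⟩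

lemma grade_induction {n : ℕ} {P : (m : ℕ) → DividedPowerAlgebra A M → Prop}
    (h_one : P 0 1) (h_mul : ∀ k m x y, P m y → P (k + m) (dp A k x * y))
    (h_zero : ∀ m, P m 0)
    (h_add : ∀ m y z, P m y → P m z → P m (y + z)) (h_smul : ∀ m (r : A) y, P m y → P m (r • y))
    {y : DividedPowerAlgebra A M} (hy : y ∈ grade A M n) : P n y := by
  induction hy using Submodule.span_induction with
  | mem y hy =>
    obtain ⟨l, rfl, rfl⟩ := hy
    induction l with
    | nil => simpa using h_one
    | cons p l ih => simpa using h_mul p.1 _ p.2 _ ih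
  | zero => exact h_zero n
  | add y z _ _ h₁ h₂ => exact h_add n y z h₁ h₂
  | smul r y _ h => exact h_smul n r y h

open scoped DirectSum in
lemma of_eq_of {i j : ℕ} (h : i = j) {a b : DividedPowerAlgebra A M} (hab : a = b)
    (ha : a ∈ grade A M i) (hb : b ∈ grade A M j) :
    DirectSum.of (fun i => grade A M i) i ⟨a, ha⟩ = DirectSum.of (fun i => grade A M i) j ⟨b, hb⟩ := by
  subst h hab; rfl

open scoped DirectSum in
variable (A M) in
/-- The decomposition of an element into its homogeneous components. -/
def decomposeHom : DividedPowerAlgebra A M →ₐ[A] ⨁ n, grade A M n :=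
  lift' (f := fun nx => DirectSum.of (fun i => grade A M i) nx.1 ⟨dp A nx.1 nx.2, dp_mem_grade _ _⟩)
    (fun x => of_eq_of rfl dp_zero _ _)
    (fun n r x => by
      rw [← DirectSum.lof_eq_of A, ← DirectSum.lof_eq_of A, ← map_smul]
      congr 1
      exact Subtype.ext dp_smul)
    (fun n p x => by
      rw [DirectSum.of_mul_of, ← map_nsmul]
      congr 1
      exact Subtype.ext dp_mul)
    (fun n x y => by
      have : ∀ k ∈ antidiagonal n,
          DirectSum.of (fun i => grade A M i) k.1 ⟨dp A k.1 x, dp_mem_grade _ _⟩ *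
            DirectSum.of (fun i => grade A M i) k.2 ⟨dp A k.2 y, dp_mem_grade _ _⟩ =
          DirectSum.of (fun i => grade A M i) n (if h : k.1 + k.2 = n then
            ⟨dp A k.1 x * dp A k.2 y, h ▸ SetLike.mul_mem_graded (dp_mem_grade _ _)
              (dp_mem_grade _ _)⟩ else 0) := by
        rintro ⟨i, j⟩ hij
        obtain rfl := mem_antidiagonal.1 hij
        rw [dif_pos rfl, DirectSum.of_mul_of]
        rfl
      dsimp only
      rw [Finset.sum_congr rfl this, ← map_sum]
      congr 1
      refine Subtype.ext ?_
      rw [AddSubmonoidClass.coe_finsetSum]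
      refine dp_add.trans ?_
      refine Finset.sum_congr rfl fun k hk => ?_
      rw [dif_pos (mem_antidiagonal.1 hk)])

open scoped DirectSum in
lemma decomposeHom_dp (n : ℕ) (x : M) : decomposeHom A M (dp A n x) =
    DirectSum.of (fun i => grade A M i) n ⟨dp A n x, dp_mem_grade n x⟩ := lift'_apply_dp _ _ _ _ _ _

instance instGradedAlgebra : GradedAlgebra (grade A M) :=
  GradedAlgebra.ofAlgHom _ (decomposeHom A M)
    (hom_ext fun n x => by
      rw [AlgHom.comp_apply, decomposeHom_dp, DirectSum.coeAlgHom_of, AlgHom.id_apply])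
    (by
      rintro n ⟨y, hy⟩
      have := grade_induction (P := fun m y => ∃ hy : y ∈ grade A M m,
        decomposeHom A M y = DirectSum.of (fun i => grade A M i) m ⟨y, hy⟩)
        ⟨SetLike.GradedOne.one_mem, map_one _⟩
        (fun k m x y ⟨hy, h⟩ => ⟨SetLike.mul_mem_graded (dp_mem_grade k x) hy, by
          rw [map_mul, h, decomposeHom_dp, DirectSum.of_mul_of]; rfl⟩)
        (fun m => ⟨zero_mem _, by rw [map_zero]; exact (map_zero _).symm⟩)
        (fun m y z ⟨hy, h⟩ ⟨hz, h'⟩ => ⟨add_mem hy hz, by rw [map_add, h, h', ← map_add]; rfl⟩)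
        (fun m r y ⟨hy, h⟩ => ⟨Submodule.smul_mem _ _ hy, by
          rw [map_smul, h, ← DirectSum.lof_eq_of A, ← map_smul]; rfl⟩) hy
      exact this.2)

lemma mul_mem_tensorGrade {m n : ℕ} {y z : DividedPowerAlgebra A M ⊗[A] DividedPowerAlgebra A M}
    (hy : y ∈ GradedDual.tensorGrade (grade A M) m)
    (hz : z ∈ GradedDual.tensorGrade (grade A M) n) :
    y * z ∈ GradedDual.tensorGrade (grade A M) (m + n) := by
  have := Submodule.mul_mem_mul hy hz
  rw [GradedDual.tensorGrade, GradedDual.tensorGrade, Submodule.span_mul_span] at this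
  refine Submodule.span_mono ?_ this
  rintro _ ⟨_, ⟨i, j, rfl, a, ha, b, hb, rfl⟩, _, ⟨i', j', rfl, a', ha', b', hb', rfl⟩, rfl⟩
  exact ⟨i + i', j + j', by omega, a * a', SetLike.mul_mem_graded ha ha', b * b',
    SetLike.mul_mem_graded hb hb', Algebra.TensorProduct.tmul_mul_tmul _ _ _ _⟩

instance instIsGradedCoalgebra : GradedDual.IsGradedCoalgebra (grade A M) where
  comul_mem n x hx :=
    grade_induction (P := fun m y => Coalgebra.comul (R := A) y ∈
        GradedDual.tensorGrade (grade A M) m)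
      (Submodule.subset_span ⟨0, 0, rfl, 1, SetLike.GradedOne.one_mem, 1,
        SetLike.GradedOne.one_mem, Bialgebra.comul_one⟩)
      (fun k m x y hy => by
        rw [Bialgebra.comul_mul, comul_dp]
        refine mul_mem_tensorGrade (Submodule.sum_mem _ fun p hp => Submodule.subset_span ?_) hy
        exact ⟨p.1, p.2, mem_antidiagonal.1 hp, _, dp_mem_grade _ _, _, dp_mem_grade _ _, rfl⟩)
      (fun m => by rw [map_zero]; exact zero_mem _)
      (fun m y z hy hz => by rw [map_add]; exact add_mem hy hz)
      (fun m r y hy => by rw [map_smul]; exact Submodule.smul_mem _ _ hy) hx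
  counit_eq_zero n x hx :=
    grade_induction (P := fun m y => m ≠ 0 → Coalgebra.counit (R := A) y = 0)
      (fun h => absurd rfl h)
      (fun k m x y hy h => by
        rw [Bialgebra.counit_mul, counit_dp]
        by_cases hk : k = 0
        · rw [hy (by omega), mul_zero]
        · rw [if_neg hk, zero_mul])
      (fun m _ => map_zero _)
      (fun m y z hy hz h => by rw [map_add, hy h, hz h, add_zero])
      (fun m r y hy h => by rw [map_smul, hy h, smul_zero]) hx

lemma map_mem_grade (g : M →ₗ[A] N) (n : ℕ) (y : DividedPowerAlgebra A M) (hy : y ∈ grade A M n) :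
    map A g y ∈ grade A N n :=
  grade_induction (P := fun m y => map A g y ∈ grade A N m)
    (by rw [map_one]; exact SetLike.GradedOne.one_mem)
    (fun k m x y hy => by
      rw [map_mul, map_apply_dp]
      exact SetLike.mul_mem_graded (dp_mem_grade _ _) hy)
    (fun m => by rw [map_zero]; exact zero_mem _)
    (fun m y z hy hz => by rw [map_add]; exact add_mem hy hz)
    (fun m r y hy => by rw [map_smul]; exact Submodule.smul_mem _ _ hy) hy

/-! ### The degree one part of the algebra of divided powers -/

variable (A M) in
/-- The projection of `Γ(M)` onto `A ⊕ M`. -/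
def toTrivSqZeroExt [Module Aᵐᵒᵖ M] [IsCentralScalar A M] :
    DividedPowerAlgebra A M →ₐ[A] TrivSqZeroExt A M :=
  lift' (f := fun nx => if nx.1 = 0 then 1 else if nx.1 = 1 then TrivSqZeroExt.inr nx.2 else 0)
    (fun _ => if_pos rfl)
    (fun n r x => by
      match n with
      | 0 => simp
      | 1 => simp
      | n + 2 => simp)
    (fun n p x => by
      match n, p with
      | 0, _ => simp
      | _, 0 => simp
      | 1, 1 => simp
      | n + 2, p + 1 => simp; omega
      | n + 1, p + 2 => simp; omega)
    (fun n x y => by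
      match n with
      | 0 => simp
      | 1 => simp [Finset.Nat.antidiagonal_succ, add_comm]
      | n + 2 =>
        rw [if_neg (by simp), if_neg (by simp), eq_comm]
        refine Finset.sum_eq_zero ?_
        rintro ⟨i, j⟩ hij
        rw [mem_antidiagonal] at hij
        match i, j with
        | 0, j => obtain rfl : j = n + 2 := by simpa using hij
                  simp
        | i, 0 => obtain rfl : i = n + 2 := by simpa using hij
                  simp
        | 1, 1 => simp
        | i + 2, j + 1 => simp
        | i + 1, j + 2 => simp)

lemma embed_injective : Function.Injective (embed A M) := by
  let _ : Module Aᵐᵒᵖ M := Module.compHom M ((RingHom.id A).fromOpposite mul_comm)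
  have _ : IsCentralScalar A M := ⟨fun _ _ => rfl⟩
  intro x y h
  have := congrArg (fun z => (toTrivSqZeroExt A M z).snd) h
  simpa [toTrivSqZeroExt, embed_def] using this

lemma embed_mem_grade (x : M) : embed A M x ∈ grade A M 1 := dp_mem_grade 1 x

variable (A M) in
/-- The canonical isomorphism `M ≅ Γ¹(M)`, `x ↦ γ¹(x)`. -/
def gradeOneEquiv : M ≃ₗ[A] grade A M 1 :=
  LinearEquiv.ofBijective ((embed A M).codRestrict (grade A M 1) embed_mem_grade) <| by
    refine ⟨fun x y h => embed_injective (congrArg Subtype.val h), ?_⟩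
    rintro ⟨y, hy⟩
    have := grade_induction (P := fun m y => (m = 0 → ∃ r : A, y = r • 1) ∧
        (m = 1 → y ∈ LinearMap.range (embed A M)))
      ⟨fun _ => ⟨1, (one_smul _ _).symm⟩, by simp⟩
      (fun k m x y hy => by
        refine ⟨fun h => ?_, fun h => ?_⟩
        · obtain rfl : k = 0 := by omega
          rw [dp_zero, one_mul]
          exact hy.1 (by omega)
        · obtain rfl | rfl : k = 0 ∨ k = 1 := by omega
          · rw [dp_zero, one_mul]
            exact hy.2 (by omega)
          · obtain ⟨r, rfl⟩ := hy.1 (by omega)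
            exact ⟨r • x, by rw [map_smul, mul_smul_comm, mul_one, embed_def]⟩)
      (fun m => ⟨fun _ => ⟨0, (zero_smul _ _).symm⟩, fun _ => zero_mem _⟩)
      (fun m y z hy hz => ⟨fun h => by
        obtain ⟨r, rfl⟩ := hy.1 h
        obtain ⟨s, rfl⟩ := hz.1 h
        exact ⟨r + s, (add_smul _ _ _).symm⟩, fun h => add_mem (hy.2 h) (hz.2 h)⟩)
      (fun m r y hy => ⟨fun h => by
        obtain ⟨s, rfl⟩ := hy.1 h
        exact ⟨r * s, (mul_smul _ _ _).symm⟩, fun h => Submodule.smul_mem _ _ (hy.2 h)⟩) hy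
    obtain ⟨x, hx⟩ := this.2 rfl
    exact ⟨x, Subtype.ext hx⟩

/-! ### The graded dual of the algebra of divided powers -/

variable (A M) in
/-- The graded dual `Γ(M)^∨`. -/
abbrev GDual : Type _ := GradedDual (grade A M)

/-- The homomorphism `Γ(N)^∨ → Γ(M)^∨` induced by `g : M → N`. -/
def GDual.map (g : M →ₗ[A] N) : GDual A N →ₐ[A] GDual A M :=
  GradedDual.map (grade A M) (grade A N) (mapBialgHom g).toCoalgHom (map_mem_grade g)

variable (A M) in
/-- The canonical map `M^* ≅ Γ¹(M)^* ⊆ Γ(M)^∨`. -/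
def GDual.ι : Module.Dual A M →ₗ[A] GDual A M :=
  GradedDual.of (grade A M) 1 ∘ₗ (gradeOneEquiv A M).symm.dualMap.toLinearMap

end DividedPowerAlgebra

namespace SymmetricAlgebra

variable {A M N : Type*} [CommRing A] [AddCommGroup M] [Module A M] [AddCommGroup N] [Module A N]

variable (A M) in
/-- `Symⁿ(M)`, spanned by the products of `n` elements of `M`. -/
def grade (n : ℕ) : Submodule A (SymmetricAlgebra A M) := LinearMap.range (ι A M) ^ n

/-- `Sym(g)`. -/
def map (g : M →ₗ[A] N) : SymmetricAlgebra A M →ₐ[A] SymmetricAlgebra A N := lift (ι A N ∘ₗ g)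

end SymmetricAlgebra

end

universe u v

/-!
Let `F` be free on a finite family `x`. By Mathlib's `submodule_span_prod_dp_eq_top` the monomials
`γ^m(x)` span `Γ(F)`, and `Δ(γ^m(x)) = ∑_{s+t=m} γ^s(x) ⊗ γ^t(x)` (`comul_dpMonomial`). The second
fact says that sending a functional `u` on `Γ(F)` to its generating series `∑ m, u(γ^m(x)) T^m`
turns convolution into multiplication of power series (`genSeries`); the first says that this is
injective. Extending homogeneous functionals by zero embeds `Γ(F)^∨` into the convolution algebra
(`GradedDual.toConv`), so `Γ(F)^∨` becomes a subalgebra of `A[[T]]` (`GDual.series`).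

The series of `γ¹(x_i)^*` is `T_i` (`GDual.series_ι_coord`). Hence the algebra homomorphism
`A[T] → Γ(F)^∨` with `T_i ↦ γ¹(x_i)^*` followed by `GDual.series` is the inclusion of `A[T]` into
`A[[T]]`. In particular, the image of `T^m` takes the value `1` on `γ^m(x)` and `0` on the other
monomials; therefore the monomials are linearly independent, hence a basis (`basis`), and the image
of `T^m` is the dual functional `γ^m(x)^*`. A functional of degree `d` vanishes on all monomials
but the finitely many of degree `d`, so its series is a homogeneous polynomial of degree `d`
(`GDual.exists_isHomogeneous`). Thus `A[T] → Γ(F)^∨` is an isomorphism of graded algebras, and the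
dual basis is multiplicative because the monomials `T^m` are.

The homomorphism `Φ_M` comes from the universal property of `Sym(M^*)`, and so do its uniqueness and
its naturality. For free `M` it is the composite of `Sym(M^*) ≃ A[T]` and `A[T] ≃ Γ(M)^∨`
(`GDual.ofSym_eq`).
-/

noncomputable section

open TensorProduct

/-! ### The graded dual inside the convolution algebra -/

namespace GradedDual

variable {A B : Type*} [CommRing A] [AddCommGroup B] [Module A B] [Coalgebra A B]
  (𝒜 : ℕ → Submodule A B) [DirectSum.Decomposition 𝒜] [IsGradedCoalgebra 𝒜]

/-- Extension by zero, as a linear map into the convolution algebra. -/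
def extConv (n : ℕ) : Piece 𝒜 n →ₗ[A] WithConv (B →ₗ[A] A) where
  toFun u := WithConv.toConv (ext 𝒜 u)
  map_add' _ _ := rfl
  map_smul' _ _ := rfl

/-- The inclusion of the graded dual into the algebra of all functionals under convolution, given
by extension by zero in each degree. -/
def toConv : GradedDual 𝒜 →ₐ[A] WithConv (B →ₗ[A] A) :=
  DirectSum.toAlgebra A (Piece 𝒜)
    (extConv 𝒜) (congrArg WithConv.toConv ext_one)
    (fun u v => congrArg WithConv.toConv (ext_mul u v))

lemma toConv_of (n : ℕ) (u : Piece 𝒜 n) :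
    toConv 𝒜 (of 𝒜 n u) = WithConv.toConv (ext 𝒜 u) :=
  DirectSum.toAddMonoid_of (fun n => (extConv 𝒜 n).toAddMonoidHom) n u

lemma toConv_apply_coe (w : GradedDual 𝒜) (n : ℕ) (x : 𝒜 n) :
    (toConv 𝒜 w).ofConv x = w n x := by
  induction w using DirectSum.induction_on with
  | zero => simp
  | add w w' h h' => rw [map_add, WithConv.ofConv_add, LinearMap.add_apply, h, h']; rfl
  | of i u =>
    rw [← DirectSum.lof_eq_of A, toConv_of, WithConv.ofConv_toConv]
    by_cases h : n = i
    · subst h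
      rw [ext_apply_coe, DirectSum.lof_apply]
    · rw [ext_apply_of_ne u x.2 h, DirectSum.lof_eq_of, DirectSum.of_eq_of_ne _ _ _ h]
      rfl

lemma toConv_injective : Function.Injective (toConv 𝒜) := by
  refine (injective_iff_map_eq_zero _).2 fun w hw => DFinsupp.ext fun n => LinearMap.ext fun x => ?_
  rw [← toConv_apply_coe, hw]
  rfl

instance instGradedMonoidGrade : SetLike.GradedMonoid (grade 𝒜) where
  one_mem := ⟨one 𝒜, rfl⟩
  mul_mem := by
    rintro i j _ _ ⟨u, rfl⟩ ⟨v, rfl⟩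
    exact ⟨mul 𝒜 u v, (of_mul_of 𝒜 u v).symm⟩

end GradedDual

/-! ### Monomials in divided powers and the generating series of a functional -/

namespace DividedPowerAlgebra

open Finset.HasAntidiagonal (antidiagonal mem_antidiagonal)

variable {A F σ : Type*} [CommRing A] [AddCommGroup F] [Module A F] [Fintype σ]

/-- The monomial `γ^m(x) = ∏ i, γ^{m i}(x i)`. -/
def dpMonomial (x : σ → F) (m : σ →₀ ℕ) : DividedPowerAlgebra A F := ∏ i, dp A (m i) (x i)

lemma dpMonomial_mem_grade (x : σ → F) (m : σ →₀ ℕ) :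
    dpMonomial x m ∈ grade A F m.degree := by
  rw [Finsupp.degree_eq_sum]
  exact SetLike.prod_mem_graded _ _ _ fun i _ => dp_mem_grade _ _

lemma dpMonomial_single [DecidableEq σ] (x : σ → F) (i : σ) (k : ℕ) :
    dpMonomial (A := A) x (Finsupp.single i k) = dp A k (x i) := by
  rw [dpMonomial, Finset.prod_eq_single i]
  · simp
  · intro j _ hj
    rw [Finsupp.single_eq_of_ne hj, dp_zero]
  · simp

lemma counit_dpMonomial [DecidableEq σ] (x : σ → F) (m : σ →₀ ℕ) :
    Coalgebra.counit (R := A) (dpMonomial (A := A) x m) = if m = 0 then 1 else 0 := by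
  rw [dpMonomial, ← Bialgebra.counitAlgHom_apply, map_prod]
  simp only [Bialgebra.counitAlgHom_apply, counit_dp]
  split_ifs with h
  · simp [h]
  · obtain ⟨i, hi⟩ := Finsupp.ne_iff.1 h
    exact Finset.prod_eq_zero (Finset.mem_univ i) (if_neg hi)

lemma prod_tmul {σ B C : Type*} [CommRing B] [Algebra A B] [CommRing C] [Algebra A C]
    (s : Finset σ) (f : σ → B) (g : σ → C) :
    ∏ i ∈ s, f i ⊗ₜ[A] g i = (∏ i ∈ s, f i) ⊗ₜ[A] (∏ i ∈ s, g i) := by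
  classical
  induction s using Finset.induction with
  | empty => simp [Algebra.TensorProduct.one_def]
  | insert i s hi h => simp only [Finset.prod_insert hi, h, Algebra.TensorProduct.tmul_mul_tmul]

/-- As `Δ` is multiplicative, this expands `∏ i, ∑_{s+t=m i} γ^s(x i) ⊗ γ^t(x i)`. -/
lemma comul_dpMonomial [DecidableEq σ] (x : σ → F) (m : σ →₀ ℕ) :
    Coalgebra.comul (R := A) (dpMonomial (A := A) x m) =
      ∑ p ∈ antidiagonal m, dpMonomial x p.1 ⊗ₜ[A] dpMonomial x p.2 := by
  rw [dpMonomial, ← Bialgebra.comulAlgHom_apply, map_prod]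
  simp only [Bialgebra.comulAlgHom_apply, comul_dp]
  refine (Finset.prod_univ_sum (fun i => antidiagonal (m i))
    (fun i k => dp A k.1 (x i) ⊗ₜ[A] dp A k.2 (x i))).trans ?_
  refine Finset.sum_bij' (fun p _ => (Finsupp.equivFunOnFinite.symm fun i : σ => (p i).1,
      Finsupp.equivFunOnFinite.symm fun i : σ => (p i).2)) (fun q _ i => (q.1 i, q.2 i))
      ?_ ?_ ?_ ?_ ?_
  · intro p hp
    rw [mem_antidiagonal]
    ext i
    exact mem_antidiagonal.1 (Fintype.mem_piFinset.1 hp i)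
  · intro q hq
    refine Fintype.mem_piFinset.2 fun i => mem_antidiagonal.2 ?_
    exact DFunLike.congr_fun (mem_antidiagonal.1 hq) i
  · intro p _
    rfl
  · intro q _
    refine Prod.ext ?_ ?_ <;> ext i <;> rfl
  · intro p _
    simp only [dpMonomial, Finsupp.equivFunOnFinite_symm_apply_apply]
    exact prod_tmul _ _ _

/-- The generating series `∑ m, u(γ^m(x)) T^m` of a functional `u` on `Γ(F)`. It turns convolution
into multiplication of power series, since `Δ(γ^m(x)) = ∑_{s+t=m} γ^s(x) ⊗ γ^t(x)`. -/
def genSeries (x : σ → F) :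
    WithConv (DividedPowerAlgebra A F →ₗ[A] A) →ₐ[A] MvPowerSeries σ A :=
  AlgHom.ofLinearMap
    { toFun u m := u.ofConv (dpMonomial x m)
      map_add' _ _ := rfl
      map_smul' _ _ := rfl }
    (by
      classical
      ext m
      rw [MvPowerSeries.coeff_one]
      refine Eq.trans ?_ (counit_dpMonomial x m)
      rfl)
    (fun u v => by
      classical
      ext m
      rw [MvPowerSeries.coeff_mul]
      change (u * v).ofConv (dpMonomial x m) = _
      rw [LinearMap.convMul_apply, comul_dpMonomial, map_sum, map_sum]
      rfl)

lemma coeff_genSeries (x : σ → F) (u : WithConv (DividedPowerAlgebra A F →ₗ[A] A)) (m : σ →₀ ℕ) :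
    MvPowerSeries.coeff m (genSeries (A := A) x u) = u.ofConv (dpMonomial x m) := rfl

lemma span_range_dpMonomial {x : σ → F} (hx : Submodule.span A (Set.range x) = ⊤) :
    Submodule.span A (Set.range (dpMonomial (A := A) x)) = ⊤ := by
  have h : dpMonomial (A := A) x = fun m => m.prod fun i k => dp A k (x i) :=
    funext fun m => (Finsupp.prod_fintype m (fun i k => dp A k (x i)) fun _ => dp_zero).symm
  rw [h, submodule_span_prod_dp_eq_top hx]

lemma genSeries_injective {x : σ → F} (hx : Submodule.span A (Set.range x) = ⊤) :
    Function.Injective (genSeries (A := A) x) := by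
  intro u v h
  refine WithConv.ofConv_injective (LinearMap.ext_on_range (span_range_dpMonomial hx) fun m => ?_)
  rw [← coeff_genSeries, h, coeff_genSeries]

/-- The generating series of an element of `Γ(F)^∨`. -/
def GDual.series (x : σ → F) : GDual A F →ₐ[A] MvPowerSeries σ A :=
  (genSeries x).comp (GradedDual.toConv (grade A F))

/-- Both factors of `GDual.series` are injective: a homogeneous functional is recovered from its
extension by zero, and a functional from its values on the monomials, which span `Γ(F)`. -/
lemma GDual.series_injective {x : σ → F} (hx : Submodule.span A (Set.range x) = ⊤) :
    Function.Injective (GDual.series (A := A) x) :=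
  (genSeries_injective hx).comp (GradedDual.toConv_injective _)

lemma GDual.coeff_series_of (x : σ → F) (n : ℕ) (u : Module.Dual A (grade A F n)) (m : σ →₀ ℕ) :
    MvPowerSeries.coeff m (GDual.series x (GradedDual.of (grade A F) n u)) =
      GradedDual.ext (grade A F) u (dpMonomial x m) := by
  rw [GDual.series, AlgHom.comp_apply, GradedDual.toConv_of, coeff_genSeries]

lemma GDual.coeff_series_of_eq_zero (x : σ → F) {n : ℕ} (u : Module.Dual A (grade A F n))
    {m : σ →₀ ℕ} (h : m.degree ≠ n) :
    MvPowerSeries.coeff m (GDual.series x (GradedDual.of (grade A F) n u)) = 0 := by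
  rw [GDual.coeff_series_of, GradedDual.ext_apply_of_ne u (dpMonomial_mem_grade x m) h]

lemma GDual.series_ι_coord (x : Module.Basis σ A F) (i : σ) :
    GDual.series x (GDual.ι A F (x.coord i)) = MvPowerSeries.X i := by
  classical
  ext m
  rw [MvPowerSeries.coeff_X]
  by_cases h : m.degree = 1
  · obtain ⟨j, rfl⟩ : ∃ j, m = Finsupp.single j 1 := by
      obtain ⟨j, hj⟩ := Finsupp.ne_iff.1 (show m ≠ 0 by rintro rfl; simp at h)
      obtain ⟨k, rfl⟩ := exists_add_of_le
        (Finsupp.single_le_iff.2 (Nat.one_le_iff_ne_zero.2 hj))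
      rw [map_add, Finsupp.degree_single, Nat.add_eq_left, Finsupp.degree_eq_zero_iff] at h
      exact ⟨j, by rw [h, add_zero]⟩
    rw [show GDual.ι A F (x.coord i) = GradedDual.of (grade A F) 1
      ((gradeOneEquiv A F).symm.dualMap (x.coord i)) from rfl, GDual.coeff_series_of,
      dpMonomial_single]
    have := GradedDual.ext_apply_coe ((gradeOneEquiv A F).symm.dualMap (x.coord i))
      (gradeOneEquiv A F (x j))
    refine this.trans ?_
    simp [Finsupp.single_left_inj, Finsupp.single_apply]
  · rw [if_neg]
    · exact GDual.coeff_series_of_eq_zero _ _ h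
    · rintro rfl
      simp at h

/-! ### The monomial basis and its dual -/

variable (x : Module.Basis σ A F)

/-- The homomorphism `A[T] → Γ(F)^∨` with `T_i ↦ γ¹(x_i)^*`. -/
def GDual.ofMvPolynomial : MvPolynomial σ A →ₐ[A] GDual A F :=
  MvPolynomial.aeval fun i => GDual.ι A F (x.coord i)

/-- The two algebra homomorphisms agree on the variables by `GDual.series_ι_coord`. -/
lemma GDual.series_ofMvPolynomial (p : MvPolynomial σ A) :
    GDual.series x (GDual.ofMvPolynomial x p) = p := by
  have : (GDual.series x).comp (GDual.ofMvPolynomial x) =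
      MvPolynomial.coeToMvPowerSeries.algHom A := by
    refine MvPolynomial.algHom_ext fun i => ?_
    simp [GDual.ofMvPolynomial, GDual.series_ι_coord]
  simpa using DFunLike.congr_fun this p

/-- The image of `T^m` in `Γ(F)^∨` has generating series `T^m`, so it takes the value `1` on
`γ^m(x)` and `0` on the other monomials. -/
lemma linearIndependent_dpMonomial : LinearIndependent A (dpMonomial (A := A) x) := by
  classical
  have key (m r : σ →₀ ℕ) :
      (GradedDual.toConv (grade A F) (GDual.ofMvPolynomial x (.monomial m 1))).ofConv
        (dpMonomial x r) = if m = r then 1 else 0 := by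
    rw [← MvPolynomial.coeff_monomial, ← MvPolynomial.coeff_coe, ← GDual.series_ofMvPolynomial x]
    rfl
  exact .of_pairwise_dual_eq_zero_one _
    (fun m => (GradedDual.toConv (grade A F) (GDual.ofMvPolynomial x (.monomial m 1))).ofConv)
    (fun m r h => (key m r).trans (if_neg h)) (fun m => (key m m).trans (if_pos rfl))

/-- The basis of `Γ(F)` of monomials in divided powers. -/
def basis : Module.Basis (σ →₀ ℕ) A (DividedPowerAlgebra A F) :=
  .mk (linearIndependent_dpMonomial x) (span_range_dpMonomial x.span_eq).ge

lemma basis_apply (m : σ →₀ ℕ) : basis x m = dpMonomial x m := Module.Basis.mk_apply _ _ m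

/-- A functional of degree `d` is the polynomial `∑ u(γ^m(x)) T^m`, over the finitely many `m` of
degree `d`, in the `γ¹(x_i)^*`. -/
lemma GDual.exists_isHomogeneous (d : ℕ) (u : Module.Dual A (grade A F d)) :
    ∃ p ∈ MvPolynomial.homogeneousSubmodule σ A d,
      GDual.ofMvPolynomial x p = GradedDual.of (grade A F) d u := by
  classical
  refine ⟨∑ m ∈ Finset.univ.finsuppAntidiag d,
    .monomial m (GradedDual.ext (grade A F) u (dpMonomial x m)), ?_, ?_⟩
  · refine Submodule.sum_mem _ fun m hm => MvPolynomial.isHomogeneous_monomial _ ?_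
    rw [Finsupp.degree_eq_sum]
    exact (Finset.mem_finsuppAntidiag.1 hm).1
  · -- Both series have the coefficient `u(γ^m(x))` at `m` of degree `d` and `0` elsewhere.
    refine GDual.series_injective x.span_eq ?_
    ext m
    rw [GDual.series_ofMvPolynomial, MvPolynomial.coeff_coe, MvPolynomial.coeff_sum]
    simp only [MvPolynomial.coeff_monomial, Finset.sum_ite_eq', Finset.mem_finsuppAntidiag]
    rw [GDual.coeff_series_of]
    split_ifs with h
    · rfl
    · rw [GradedDual.ext_apply_of_ne u (dpMonomial_mem_grade _ m)]
      rw [Finsupp.degree_eq_sum]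
      simpa using h

lemma GDual.ofMvPolynomial_bijective : Function.Bijective (GDual.ofMvPolynomial x) := by
  refine ⟨fun p q h => MvPolynomial.coe_injective σ A ?_, ?_⟩
  · rw [← GDual.series_ofMvPolynomial x, h, GDual.series_ofMvPolynomial]
  · intro w
    induction w using DirectSum.induction_on with
    | zero => exact ⟨0, map_zero _⟩
    | add w w' h h' =>
      obtain ⟨p, rfl⟩ := h
      obtain ⟨q, rfl⟩ := h'
      exact ⟨p + q, map_add _ _ _⟩
    | of d u =>
      obtain ⟨p, -, hp⟩ := GDual.exists_isHomogeneous x d u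
      exact ⟨p, hp⟩

/-- The isomorphism `A[T] ≃ Γ(F)^∨` with `T_i ↦ γ¹(x_i)^*`. -/
def GDual.equivMvPolynomial : MvPolynomial σ A ≃ₐ[A] GDual A F :=
  .ofBijective (GDual.ofMvPolynomial x) (GDual.ofMvPolynomial_bijective x)

lemma GDual.equivMvPolynomial_apply (p : MvPolynomial σ A) :
    GDual.equivMvPolynomial x p = GDual.ofMvPolynomial x p := rfl

lemma GDual.equivMvPolynomial_X (i : σ) :
    GDual.equivMvPolynomial x (.X i) = GDual.ι A F (x.coord i) := MvPolynomial.aeval_X _ i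

/-- The image of `T^m` is the functional dual to `γ^m(x)`. -/
lemma GDual.equivMvPolynomial_monomial (m : σ →₀ ℕ) :
    GDual.equivMvPolynomial x (.monomial m 1) = GradedDual.of (grade A F) m.degree
      ((basis x).coord m ∘ₗ (grade A F m.degree).subtype) := by
  classical
  refine GDual.series_injective x.span_eq ?_
  ext r
  rw [GDual.equivMvPolynomial_apply, GDual.series_ofMvPolynomial, MvPolynomial.coeff_coe,
    MvPolynomial.coeff_monomial, GDual.coeff_series_of]
  by_cases h : r.degree = m.degree
  · refine Eq.trans ?_ (GradedDual.ext_apply_coe _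
      ⟨dpMonomial x r, h ▸ dpMonomial_mem_grade x r⟩).symm
    simp [← basis_apply, Finsupp.single_apply, eq_comm]
  · rw [GradedDual.ext_apply_of_ne _ (dpMonomial_mem_grade x r) h, if_neg]
    rintro rfl
    exact h rfl

lemma GDual.map_equivMvPolynomial_homogeneousSubmodule (d : ℕ) :
    (MvPolynomial.homogeneousSubmodule σ A d).map (GDual.equivMvPolynomial x).toLinearMap =
      GradedDual.grade (grade A F) d := by
  refine le_antisymm ?_ ?_
  · rintro _ ⟨p, hp, rfl⟩
    rw [p.as_sum, map_sum]
    refine Submodule.sum_mem _ fun m hm => ?_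
    obtain rfl : m.degree = d := by
      by_contra h
      exact MvPolynomial.mem_support_iff.1 hm (MvPolynomial.IsHomogeneous.coeff_eq_zero hp h)
    rw [← mul_one (p.coeff m), ← smul_eq_mul, ← MvPolynomial.smul_monomial, map_smul]
    refine Submodule.smul_mem _ _ ?_
    exact ⟨_, (GDual.equivMvPolynomial_monomial x m).symm⟩
  · rintro _ ⟨u, rfl⟩
    obtain ⟨p, hp, h⟩ := GDual.exists_isHomogeneous x d u
    exact ⟨p, hp, h⟩

/-! ### The homomorphism from the symmetric algebra -/

instance _root_.SymmetricAlgebra.instGradedMonoidGrade {M : Type*} [AddCommGroup M] [Module A M] :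
    SetLike.GradedMonoid (SymmetricAlgebra.grade A M) :=
  inferInstanceAs (SetLike.GradedMonoid (LinearMap.range (SymmetricAlgebra.ι A M) ^ ·))

variable {M N : Type*} [AddCommGroup M] [Module A M] [AddCommGroup N] [Module A N]

variable (A M) in
/-- The homomorphism `Φ_M : Sym(M^*) → Γ(M)^∨` extending the canonical map on `M^*`. -/
def GDual.ofSym : SymmetricAlgebra A (Module.Dual A M) →ₐ[A] GDual A M :=
  SymmetricAlgebra.lift (GDual.ι A M)

lemma GDual.ofSym_comp_ι :
    (GDual.ofSym A M).toLinearMap ∘ₗ SymmetricAlgebra.ι A (Module.Dual A M) = GDual.ι A M :=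
  LinearMap.ext fun f => SymmetricAlgebra.lift_ι_apply _ f

lemma GDual.ofSym_ι (f : Module.Dual A M) :
    GDual.ofSym A M (SymmetricAlgebra.ι A _ f) = GDual.ι A M f := SymmetricAlgebra.lift_ι_apply _ f

lemma GDual.map_ofSym_grade_le (d : ℕ) :
    (SymmetricAlgebra.grade A (Module.Dual A M) d).map (GDual.ofSym A M).toLinearMap ≤
      GradedDual.grade (grade A M) d := by
  rw [SymmetricAlgebra.grade, Submodule.map_pow, ← LinearMap.range_comp, GDual.ofSym_comp_ι]
  have h₁ : LinearMap.range (GDual.ι A M) ≤ GradedDual.grade (grade A M) 1 := by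
    rintro _ ⟨f, rfl⟩
    exact ⟨_, rfl⟩
  induction d with
  | zero =>
    rw [pow_zero, Submodule.one_le]
    exact SetLike.GradedOne.one_mem
  | succ d ih =>
    rw [pow_succ, Submodule.mul_le]
    exact fun a ha b hb => SetLike.mul_mem_graded (ih ha) (h₁ hb)

lemma GDual.map_ι (g : M →ₗ[A] N) (f : Module.Dual A N) :
    GDual.map g (GDual.ι A N f) = GDual.ι A M (g.dualMap f) := by
  refine (GradedDual.map_of _ _ _ _ 1 _).trans ?_
  refine congrArg (GradedDual.of (grade A M) 1) (LinearMap.ext fun y => ?_)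
  obtain ⟨x, rfl⟩ := (gradeOneEquiv A M).surjective y
  have h : ((mapBialgHom g).toCoalgHom :
      DividedPowerAlgebra A M →ₗ[A] DividedPowerAlgebra A N).restrict (map_mem_grade g 1)
        (gradeOneEquiv A M x) = gradeOneEquiv A N (g x) :=
    Subtype.ext (map_apply_dp A g)
  simp [LinearMap.dualMap_apply, h]

lemma GDual.map_comp_ofSym (g : M →ₗ[A] N) :
    (GDual.map g).comp (GDual.ofSym A N) =
      (GDual.ofSym A M).comp (SymmetricAlgebra.map g.dualMap) := by
  refine SymmetricAlgebra.algHom_ext (LinearMap.ext fun f => ?_)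
  change GDual.map g (GDual.ofSym A N (SymmetricAlgebra.ι A _ f)) =
    GDual.ofSym A M (SymmetricAlgebra.map g.dualMap (SymmetricAlgebra.ι A _ f))
  rw [GDual.ofSym_ι, GDual.map_ι, SymmetricAlgebra.map, SymmetricAlgebra.lift_ι_apply]
  exact (GDual.ofSym_ι _).symm

lemma GDual.ofSym_eq [DecidableEq σ] :
    GDual.ofSym A F = ((SymmetricAlgebra.equivMvPolynomial x.dualBasis).trans
      (GDual.equivMvPolynomial x)).toAlgHom := by
  refine SymmetricAlgebra.algHom_ext (x.dualBasis.ext fun i => ?_)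
  change GDual.ofSym A F (SymmetricAlgebra.ι A _ (x.dualBasis i)) =
    GDual.equivMvPolynomial x (SymmetricAlgebra.equivMvPolynomial x.dualBasis
      (SymmetricAlgebra.ι A _ (x.dualBasis i)))
  rw [GDual.ofSym_ι, SymmetricAlgebra.equivMvPolynomial_ι_apply, GDual.equivMvPolynomial_X,
    Module.Basis.coe_dualBasis]

lemma GDual.ofSym_bijective [Module.Finite A M] [Module.Free A M] :
    Function.Bijective (GDual.ofSym A M) := by
  classical
  rw [GDual.ofSym_eq (Module.Free.chooseBasis A M)]
  exact AlgEquiv.bijective _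

lemma GDual.map_ofSym_grade [Module.Finite A M] [Module.Free A M] (d : ℕ) :
    (SymmetricAlgebra.grade A (Module.Dual A M) d).map (GDual.ofSym A M).toLinearMap =
      GradedDual.grade (grade A M) d := by
  classical
  refine le_antisymm (GDual.map_ofSym_grade_le d) ?_
  let x := Module.Free.chooseBasis A M
  -- The part of degree `d` is spanned by the images of the monomials `T^m` with `m.degree = d`, and
  -- each of these comes from the product of the `(x.coord i) ^ m i` in the symmetric algebra.
  rw [← GDual.map_equivMvPolynomial_homogeneousSubmodule x d]
  rintro _ ⟨p, hp, rfl⟩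
  rw [p.as_sum, map_sum]
  refine Submodule.sum_mem _ fun m hm => ?_
  obtain rfl : m.degree = d := by
    by_contra h
    exact MvPolynomial.mem_support_iff.1 hm (MvPolynomial.IsHomogeneous.coeff_eq_zero hp h)
  rw [← mul_one (p.coeff m), ← smul_eq_mul, ← MvPolynomial.smul_monomial, map_smul]
  refine Submodule.smul_mem _ _ ⟨∏ i, SymmetricAlgebra.ι A _ (x.coord i) ^ m i, ?_, ?_⟩
  · rw [Finsupp.degree_eq_sum]
    refine SetLike.prod_mem_graded (SymmetricAlgebra.grade A (Module.Dual A M)) _ _ fun i _ => ?_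
    exact Submodule.pow_mem_pow _ (LinearMap.mem_range_self _ _) _
  · simp [GDual.ofSym_ι, GDual.equivMvPolynomial_apply, GDual.ofMvPolynomial,
      MvPolynomial.aeval_monomial, Finsupp.prod_fintype]

end DividedPowerAlgebra

end

theorem mainTheorem2 (A : Type u) [CommRing A] :
    -- the natural homomorphism `Sym(M^*) → Γ(M)^∨` for finitely generated `M`
    (∃ Φ : ∀ (M : Type v) [AddCommGroup M] [Module A M] [Module.Finite A M],
        SymmetricAlgebra A (Module.Dual A M) →ₐ[A] DividedPowerAlgebra.GDual A M,
      -- it is the unique algebra homomorphism extending the canonical map on `M^*`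
      (∀ (M : Type v) [AddCommGroup M] [Module A M] [Module.Finite A M],
        (Φ M).toLinearMap ∘ₗ SymmetricAlgebra.ι A (Module.Dual A M) =
          DividedPowerAlgebra.GDual.ι A M ∧
        ∀ ψ : SymmetricAlgebra A (Module.Dual A M) →ₐ[A] DividedPowerAlgebra.GDual A M,
          ψ.toLinearMap ∘ₗ SymmetricAlgebra.ι A (Module.Dual A M) =
            DividedPowerAlgebra.GDual.ι A M → ψ = Φ M) ∧
      -- it is graded
      (∀ (M : Type v) [AddCommGroup M] [Module A M] [Module.Finite A M] (d : ℕ),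
        (SymmetricAlgebra.grade A (Module.Dual A M) d).map (Φ M).toLinearMap ≤
          GradedDual.grade (DividedPowerAlgebra.grade A M) d) ∧
      -- it is natural
      (∀ (M N : Type v) [AddCommGroup M] [Module A M] [Module.Finite A M]
        [AddCommGroup N] [Module A N] [Module.Finite A N] (g : M →ₗ[A] N),
        (DividedPowerAlgebra.GDual.map g).comp (Φ N) =
          (Φ M).comp (SymmetricAlgebra.map g.dualMap)) ∧
      -- it is an isomorphism of graded algebras if `M` is free
      (∀ (M : Type v) [AddCommGroup M] [Module A M] [Module.Finite A M] [Module.Free A M],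
        Function.Bijective (Φ M) ∧
        ∀ d : ℕ, (SymmetricAlgebra.grade A (Module.Dual A M) d).map (Φ M).toLinearMap =
          GradedDual.grade (DividedPowerAlgebra.grade A M) d)) ∧
    -- for `F` free on `x₁, …, xₙ`, `Γ(F)^∨` is the polynomial ring on the `γ¹(xᵢ)^*`
    (∀ (F : Type v) [AddCommGroup F] [Module A F] (n : ℕ) (x : Module.Basis (Fin n) A F),
      ∃ (b : Module.Basis (Fin n →₀ ℕ) A (DividedPowerAlgebra A F))
        (D : Module.Basis (Fin n →₀ ℕ) A (DividedPowerAlgebra.GDual A F))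
        (e : MvPolynomial (Fin n) A ≃ₐ[A] DividedPowerAlgebra.GDual A F),
        -- `b` consists of the monomials in divided powers, and `D` of their duals
        (∀ m, b m = ∏ i, DividedPowerAlgebra.dp A (m i) (x i)) ∧
        (∀ m, D m = GradedDual.of (DividedPowerAlgebra.grade A F) m.degree
          (b.coord m ∘ₗ (DividedPowerAlgebra.grade A F m.degree).subtype)) ∧
        (∀ i, D (Finsupp.single i 1) = DividedPowerAlgebra.GDual.ι A F (x.coord i)) ∧
        -- the dual basis is multiplicative
        D 0 = 1 ∧
        (∀ m r, D (m + r) = D m * D r) ∧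
        (∀ m, D m = ∏ i, D (Finsupp.single i 1) ^ m i) ∧
        -- the resulting isomorphism of graded algebras
        (∀ i, e (MvPolynomial.X i) = D (Finsupp.single i 1)) ∧
        (∀ d : ℕ, (MvPolynomial.homogeneousSubmodule (Fin n) A d).map e.toLinearMap =
          GradedDual.grade (DividedPowerAlgebra.grade A F) d)) := by
  refine ⟨⟨fun M _ _ _ => DividedPowerAlgebra.GDual.ofSym A M, fun M _ _ _ => ⟨?_, fun ψ hψ => ?_⟩,
    fun M _ _ _ d => DividedPowerAlgebra.GDual.map_ofSym_grade_le d,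
    fun M N _ _ _ _ _ _ g => DividedPowerAlgebra.GDual.map_comp_ofSym g,
    fun M _ _ _ _ => ⟨DividedPowerAlgebra.GDual.ofSym_bijective,
      DividedPowerAlgebra.GDual.map_ofSym_grade⟩⟩, fun F _ _ n x => ?_⟩
  · exact DividedPowerAlgebra.GDual.ofSym_comp_ι
  · exact SymmetricAlgebra.algHom_ext (hψ.trans DividedPowerAlgebra.GDual.ofSym_comp_ι.symm)
  let e := DividedPowerAlgebra.GDual.equivMvPolynomial x
  let D := (MvPolynomial.basisMonomials (Fin n) A).map e.toLinearEquiv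
  have hD (m : Fin n →₀ ℕ) : D m = e (.monomial m 1) := by simp [D]
  have hX (i : Fin n) : D (.single i 1) = e (.X i) := hD _
  refine ⟨DividedPowerAlgebra.basis x, D, e, DividedPowerAlgebra.basis_apply x,
    fun m => (hD m).trans (DividedPowerAlgebra.GDual.equivMvPolynomial_monomial x m),
    fun i => (hX i).trans (DividedPowerAlgebra.GDual.equivMvPolynomial_X x i), ?_, ?_, ?_,
    fun i => (hX i).symm, DividedPowerAlgebra.GDual.map_equivMvPolynomial_homogeneousSubmodule x⟩
  · rw [hD, MvPolynomial.monomial_zero', map_one, map_one]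
  · intro m r
    rw [hD, hD, hD, ← map_mul, MvPolynomial.monomial_mul, one_mul]
  · intro m
    simp only [hX]
    rw [hD, MvPolynomial.monomial_eq, map_one, one_mul, Finsupp.prod_fintype _ _ (by simp),
      map_prod]
    simp only [map_pow]
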